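/- **Setting.** Let $k>1$ be an integer, $o\in\mathbb R$, $L,R\ge 0$ with $D=L+R>0$, $0\le\delta\le 1$, $\Delta=\delta D$ and $\gamma=\max\{L,R\}/D$. A *request sequence* $\sigma$ is a finite sequence of requests $(t_i,e_i)$, $t_i\ge 0$, $e_i\in[o-L,o+R]$, listed in order of release time $t_i$, such that $o-L$ and $o+R$ are the extreme points of $\{o\}\cup\{e_i\}$. There are $k$ servers that start at $o$ at time $0$, stay on $[o-L,o+R]$ and move with speed at most $1$. A request $(t_i,e_i)$ is served when some server is at $e_i$ at a time $\ge t_i$; servers need not return to $o$ (nomadic oTsp). The cost of a schedule is the time at which the last request is served, and $OPT(\sigma)$ is the optimal offline cost with $k$ servers. A deterministic online algorithm knows $k,o,L,R,\Delta$ in advance, and its server positions at time $t$ depend only on the requests released up to time $t$. It is $c$-competitive if it serves all requests and its cost is at most $c\cdot OPT(\sigma)$ for every $\sigma$; in the *spatial locality model* this is required only for those $\sigma$ in which each request is released within distance $\Delta$ of the position, at its release time, of at least one of the algorithm's servers. **Algorithm.** Split the servers into two nonempty teams, "left first" and "right first". Whenever a request is released, let $\ell\le r$ be the extreme positions of the outstanding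 requests; each server at position $p$ computes a tour: if $\ell,r$ lie on the same side of $p$ (including $p$), it goes from $p$ to the farther of the two; otherwise it goes to $\ell$ and then to $r$ if it is a left-first server, and to $r$ and then to $\ell$ if it is a right-first server. The servers follow their tours with unit speed until a new request is released (then the tours are recomputed) or no request is outstanding (then they stay where they are). Call this algorithm $P$. Given an online algorithm $B$ for the original model (no locality assumption), the *parallelized algorithm* $P_B$ runs $B$ if $2+\delta/\gamma\ge 2.04$ and runs $P$ otherwise. **Theorem.** We have $\tfrac12\le\gamma\le 1$. Moreover: 1. There is a deterministic online algorithm $B$ with $k$ servers that is $2.04$-competitive in the original model on $[o-L,o+R]$; and for every such $B$ the parallelized algorithm $P_B$ is $\min\{2.04,\,2+\delta/\gamma\}$-competitive in the spatial locality model with locality $\Delta$. 2. For all values of the parameters, $P$ itself is $(2+\delta/\gamma)$-competitive in the spatial locality model with locality $\Delta$. More precisely, with $t_{\max}$ the last release time, $OPT(\sigma)\ge\max\{t_{\max},L,R\}$ for every $\sigma$, and $P$ has cost at most $t_{\max}+\Delta+\max\{L,R\}$ on every $\sigma$ with locality $\Delta$. -/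

import Mathlib

/-- A request of nomadic online TSP on the line: a release time and a point to be visited. -/
structure Request where
  release : ℝ
  loc : ℝ

/-- The motion of `k` servers: `X t j` is the position of server `j` at time `t ≥ 0`. -/
abbrev Motion (k : ℕ) := ℝ → Fin k → ℝ

/-- `σ` is a finite request sequence on the segment `[o - L, o + R]`, listed in order of release,
with nonnegative release times. -/
def IsRequestSeq (o L R : ℝ) (σ : List Request) : Prop :=
  σ.Pairwise (fun r r' => r.release ≤ r'.release) ∧
    ∀ r ∈ σ, 0 ≤ r.release ∧ r.loc ∈ Set.Icc (o - L) (o + R)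

/-- `o - L` and `o + R` are the two extreme positions of the requests together with the
origin `o`. -/
def Spans (o L R : ℝ) (σ : List Request) : Prop :=
  IsLeast (insert o {x | ∃ r ∈ σ, r.loc = x}) (o - L) ∧
    IsGreatest (insert o {x | ∃ r ∈ σ, r.loc = x}) (o + R)

/-- All servers start at the origin, move with at most unit speed, and stay on the segment. -/
def IsSchedule {k : ℕ} (o L R : ℝ) (X : Motion k) : Prop :=
  (∀ j, X 0 j = o) ∧
    (∀ s t, 0 ≤ s → s ≤ t → ∀ j, |X t j - X s j| ≤ t - s) ∧
    ∀ t, 0 ≤ t → ∀ j, X t j ∈ Set.Icc (o - L) (o + R)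

/-- Every request of `σ` has been served by time `T`: some server is at its location at some time
that is not before its release and not after `T`. -/
def AllServedBy {k : ℕ} (X : Motion k) (σ : List Request) (T : ℝ) : Prop :=
  0 ≤ T ∧ ∀ r ∈ σ, ∃ t, r.release ≤ t ∧ t ≤ T ∧ ∃ j, X t j = r.loc

/-- The cost of a motion on `σ`: the maximum completion time of the requests. -/
noncomputable def cost {k : ℕ} (X : Motion k) (σ : List Request) : ℝ :=
  sInf {T | AllServedBy X σ T}

/-- The optimal offline cost with `k` servers. -/
noncomputable def OPT (k : ℕ) (o L R : ℝ) (σ : List Request) : ℝ :=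
  sInf {T | ∃ X : Motion k, IsSchedule o L R X ∧ AllServedBy X σ T}

/-- The last release time `t_max`. -/
noncomputable def tmax (σ : List Request) : ℝ :=
  (σ.map Request.release).foldr max 0

/-- A strategy maps a request sequence to a motion of the servers. -/
abbrev Strategy (k : ℕ) := List Request → Motion k

open Classical in
/-- The requests released up to time `t`. -/
noncomputable def released (σ : List Request) (t : ℝ) : List Request :=
  σ.filter (fun r => r.release ≤ t)

/-- A deterministic online algorithm on the segment `[o - L, o + R]`: on every request sequence it
produces a legal schedule, and the positions at time `t` depend only on the requests released up to
time `t`. -/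
def IsOnline {k : ℕ} (o L R : ℝ) (A : Strategy k) : Prop :=
  (∀ σ, IsRequestSeq o L R σ → IsSchedule o L R (A σ)) ∧
    ∀ σ σ', IsRequestSeq o L R σ → IsRequestSeq o L R σ' →
      ∀ t, 0 ≤ t → released σ t = released σ' t → A σ t = A σ' t

/-- Spatial locality `Δ`: every request is released within distance `Δ` of the current position of
at least one server. -/
def SpatialLocality {k : ℕ} (Δ : ℝ) (X : Motion k) (σ : List Request) : Prop :=
  ∀ r ∈ σ, ∃ j, |X r.release j - r.loc| ≤ Δ

/-- `c`-competitiveness in the original online model (no locality). -/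
def IsCompetitive {k : ℕ} (o L R : ℝ) (A : Strategy k) (c : ℝ) : Prop :=
  IsOnline o L R A ∧
    ∀ σ, IsRequestSeq o L R σ → Spans o L R σ →
      (∃ T, AllServedBy (A σ) σ T) ∧ cost (A σ) σ ≤ c * OPT k o L R σ

/-- `c`-competitiveness in the spatial locality model with locality `Δ`. -/
def IsCompetitiveWithLocality {k : ℕ} (o L R Δ : ℝ) (A : Strategy k) (c : ℝ) : Prop :=
  IsOnline o L R A ∧
    ∀ σ, IsRequestSeq o L R σ → Spans o L R σ → SpatialLocality Δ (A σ) σ →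
      (∃ T, AllServedBy (A σ) σ T) ∧ cost (A σ) σ ≤ c * OPT k o L R σ

/-- The point reached from `p` after moving a distance `s ≥ 0` towards `q`, stopping at `q`. -/
noncomputable def moveToward (p q s : ℝ) : ℝ := max (p - s) (min q (p + s))

/-- The point reached after distance `s ≥ 0` on the tour from `p` to `a` and then to `b`. -/
noncomputable def walk (p a b s : ℝ) : ℝ :=
  if s ≤ |a - p| then moveToward p a s else moveToward a b (s - |a - p|)

/-- Positions of the servers and locations of the outstanding requests. -/
structure ServerState (k : ℕ) where
  pos : Fin k → ℝ
  out : Finset ℝ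

/-- The two successive stops of the tour of a server at `p`, where `lo` and `hi` are the extreme
locations of the outstanding requests. If both extremes are on the same side of `p`, the tour goes
to the farther one. Otherwise it visits both extremes: servers with `leftFirst = true` visit the
left one first, the other servers the right one first. -/
noncomputable def tourStops (leftFirst : Bool) (p lo hi : ℝ) : ℝ × ℝ :=
  if hi ≤ p then (lo, lo)
  else if p ≤ lo then (hi, hi)
  else if leftFirst then (lo, hi) else (hi, lo)

namespace ServerState

variable {k : ℕ}

/-- Position of server `j` after following its tour for time `s`. -/
noncomputable def onTour (side : Fin k → Bool) (S : ServerState k) (j : Fin k) (s : ℝ) : ℝ :=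
  let q := tourStops (side j) (S.pos j) (sInf (S.out : Set ℝ)) (sSup (S.out : Set ℝ))
  walk (S.pos j) q.1 q.2 s

/-- Some server passes the point `e` on its tour within time `s`. -/
def Visits (side : Fin k → Bool) (S : ServerState k) (s e : ℝ) : Prop :=
  ∃ j, ∃ u, 0 ≤ u ∧ u ≤ s ∧ S.onTour side j u = e

/-- The time after which no request is outstanding, if no new request arrives. -/
noncomputable def clearTime (side : Fin k → Bool) (S : ServerState k) : ℝ :=
  sInf {s | 0 ≤ s ∧ ∀ e ∈ S.out, S.Visits side s e}

open Classical in
/-- The state after time `s` without new requests: the servers follow their tours, and stay where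
they are as soon as no request is outstanding. -/
noncomputable def advance (side : Fin k → Bool) (S : ServerState k) (s : ℝ) : ServerState k where
  pos j := S.onTour side j (min s (S.clearTime side))
  out := S.out.filter (fun e => ¬ S.Visits side s e)

end ServerState

/-- The state right after the last request of a sequence has been released, together with the time
of that release; the tours are recomputed whenever a request is released. -/
noncomputable def runState {k : ℕ} (side : Fin k → Bool) (o : ℝ) (σ : List Request) :
    ℝ × ServerState k :=
  σ.foldl
    (fun P r =>
      let S := P.2.advance side (r.release - P.1)
      (r.release, { pos := S.pos, out := insert r.loc S.out }))
    (0, { pos := fun _ => o, out := ∅ })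

/-- The parallelized two-extremes algorithm on the line: the `k` servers are split by `side` into
two teams that run the two possible orders of the tour through the extreme outstanding requests
in parallel. -/
noncomputable def parallelTour {k : ℕ} (side : Fin k → Bool) (o : ℝ) : Strategy k :=
  fun σ t j =>
    let P := runState side o (released σ t)
    (P.2.advance side (t - P.1)).pos j

open Classical in
/-- The parallelized algorithm with its initial test: if `2 + δ / γ ≥ 2.04` it runs the
original-model algorithm `B`, and otherwise it runs `parallelTour`. -/
noncomputable def parallelAlgorithm {k : ℕ} (side : Fin k → Bool) (o δ γ : ℝ) (B : Strategy k) :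
    Strategy k :=
  if 2 + δ / γ ≥ 2.04 then B else parallelTour side o

/-! No schedule finishes before the last release, nor before the ends of the segment can be reached
from `o`; hence OPT ≥ max{t_max, L, R}, and all online costs are compared with this quantity.

For P, the point is the invariant `Teams`: the left-first servers share a position p, the
right-first servers share a position q ≥ p, and all outstanding requests lie in [p - Δ, q + Δ].
Locality provides this for a new request. Along the tours it survives because a server that has
turned leaves only served points behind it (`tour_true_le_of_not_passed`), and because the teams
cross only after everything has been served (`tours_crossed`). So after the last release each team
needs at most Δ to turn at its own extreme, and two opposite sweeps of length D/2 ≤ max{L, R} cover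
the rest (`tours_cover`). This gives cost at most t_max + Δ + max{L, R}, where Δ = (δ/γ) max{L, R}.

For the original model, knowing the ends already gives ratio 2: one team waits at each end and
sweeps its half so late that it finishes at time 2 max{t_max, L, R}. If a release interrupts the
sweep, every server can still return to its end before the postponed sweep begins
(`sweepDepth_le_slack`). -/

/-! ### Event-driven rules produce legal online schedules -/

/-- An event-driven rule for `k` servers: the state changes only when a request is released, and
between releases the positions are a function of the state and the time. -/
structure EventRule (S : Type*) (k : ℕ) where
  init : S
  time : S → ℝ
  step : S → Request → S
  pos : S → Motion k

namespace EventRule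

variable {S : Type*} {k : ℕ}

/-- The state after all requests of a sequence have been released. -/
def state (E : EventRule S k) (σ : List Request) : S := σ.foldl E.step E.init

/-- The strategy described by an event-driven rule. -/
noncomputable def strategy (E : EventRule S k) : Strategy k :=
  fun σ t => E.pos (E.state (released σ t)) t

/-- The states satisfying `Inv` are preserved, and the motions out of them are legal and fit
together at the releases. -/
structure Legal (E : EventRule S k) (o L R : ℝ) (Inv : S → Prop) : Prop where
  time_init : E.time E.init = 0
  time_step : ∀ P r, E.time (E.step P r) = r.release
  pos_init : ∀ j, E.pos E.init 0 j = o
  inv_init : Inv E.init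
  inv_step : ∀ P r, Inv P → E.time P ≤ r.release → r.loc ∈ Set.Icc (o - L) (o + R) →
    Inv (E.step P r)
  pos_step : ∀ P r, Inv P → E.time P ≤ r.release →
    E.pos (E.step P r) r.release = E.pos P r.release
  lipschitz : ∀ P, Inv P → ∀ s t, E.time P ≤ s → s ≤ t → ∀ j, |E.pos P t j - E.pos P s j| ≤ t - s
  mem : ∀ P, Inv P → ∀ t, E.time P ≤ t → ∀ j, E.pos P t j ∈ Set.Icc (o - L) (o + R)

end EventRule

theorem IsRequestSeq.of_append {o L R : ℝ} {σ : List Request} {r : Request}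
    (h : IsRequestSeq o L R (σ ++ [r])) :
    IsRequestSeq o L R σ ∧ (∀ r' ∈ σ, r'.release ≤ r.release) ∧ 0 ≤ r.release ∧
      r.loc ∈ Set.Icc (o - L) (o + R) := by
  obtain ⟨h1, h2⟩ := h
  rw [List.pairwise_append] at h1
  refine ⟨⟨h1.1, fun x hx => h2 x (by simp [hx])⟩, fun x hx => h1.2.2 x hx r (by simp), ?_⟩
  exact h2 r (by simp)

theorem released_eq_self {σ : List Request} {t : ℝ} (h : ∀ r ∈ σ, r.release ≤ t) :
    released σ t = σ := by
  unfold released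
  rw [List.filter_eq_self]
  simpa using h

theorem released_append_of_lt {σ : List Request} {r : Request} {t : ℝ} (h : t < r.release) :
    released (σ ++ [r]) t = released σ t := by
  simp [released, List.filter_append, h]

namespace EventRule

variable {S : Type*} {k : ℕ} {E : EventRule S k} {o L R : ℝ} {Inv : S → Prop}

theorem state_append (σ : List Request) (r : Request) :
    E.state (σ ++ [r]) = E.step (E.state σ) r := by
  simp [state]

theorem strategy_of_ge {σ : List Request} {t : ℝ} (h : ∀ r ∈ σ, r.release ≤ t) :
    E.strategy σ t = E.pos (E.state σ) t := by
  simp only [strategy, released_eq_self h]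

theorem Legal.time_state_le (hE : E.Legal o L R Inv) {σ : List Request} {t : ℝ} (ht : 0 ≤ t)
    (h : ∀ r ∈ σ, r.release ≤ t) : E.time (E.state σ) ≤ t := by
  induction σ using List.reverseRecOn with
  | nil => simpa [state, hE.time_init] using ht
  | append_singleton σ r _ =>
    rw [state_append, hE.time_step]
    exact h r (by simp)

theorem Legal.release_le_time (hE : E.Legal o L R Inv) {σ : List Request}
    (hσ : IsRequestSeq o L R σ) : ∀ r ∈ σ, r.release ≤ E.time (E.state σ) := by
  induction σ using List.reverseRecOn with
  | nil => simp
  | append_singleton σ r _ =>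
    rw [state_append, hE.time_step]
    intro x hx
    rcases List.mem_append.1 hx with hx | hx
    · exact hσ.of_append.2.1 x hx
    · simp_all

theorem Legal.time_nonneg (hE : E.Legal o L R Inv) {σ : List Request}
    (hσ : IsRequestSeq o L R σ) : 0 ≤ E.time (E.state σ) := by
  induction σ using List.reverseRecOn with
  | nil => simp [state, hE.time_init]
  | append_singleton σ r _ =>
    rw [state_append, hE.time_step]
    exact hσ.of_append.2.2.1

theorem Legal.inv_state (hE : E.Legal o L R Inv) {σ : List Request}
    (hσ : IsRequestSeq o L R σ) : Inv (E.state σ) := by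
  induction σ using List.reverseRecOn with
  | nil => exact hE.inv_init
  | append_singleton σ r ih =>
    obtain ⟨h1, h2, h3, h4⟩ := hσ.of_append
    rw [state_append]
    exact hE.inv_step _ _ (ih h1) (hE.time_state_le h3 h2) h4

/-- Inductions on the last request rest on this. At `t = r.release` the new request already counts
as released, so there the equality comes from `pos_step` and not from `released`. -/
theorem Legal.strategy_append (hE : E.Legal o L R Inv) {σ : List Request} {r : Request}
    (hσ : IsRequestSeq o L R (σ ++ [r])) {t : ℝ} (ht : t ≤ r.release) :
    E.strategy (σ ++ [r]) t = E.strategy σ t := by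
  obtain ⟨h1, h2, h3, h4⟩ := hσ.of_append
  rcases ht.lt_or_eq with h | rfl
  · simp only [strategy, released_append_of_lt h]
  · rw [strategy_of_ge h2, strategy_of_ge, state_append,
      hE.pos_step _ _ (hE.inv_state h1) (hE.time_state_le h3 h2)]
    intro x hx
    rcases List.mem_append.1 hx with hx | hx
    · exact h2 x hx
    · simp_all

theorem Legal.isSchedule (hE : E.Legal o L R Inv) {σ : List Request}
    (hσ : IsRequestSeq o L R σ) : IsSchedule o L R (E.strategy σ) := by
  induction σ using List.reverseRecOn with
  | nil =>
    have h0 : ∀ t, E.strategy [] t = E.pos E.init t := fun t => strategy_of_ge (by simp)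
    refine ⟨fun j => by rw [h0, hE.pos_init], fun s t hs hst j => ?_, fun t ht j => ?_⟩
    · rw [h0, h0]
      exact hE.lipschitz _ hE.inv_init s t (by rwa [hE.time_init]) hst j
    · rw [h0]
      exact hE.mem _ hE.inv_init t (by rwa [hE.time_init]) j
  | append_singleton σ r ih =>
    obtain ⟨h1, h2, h3, h4⟩ := hσ.of_append
    obtain ⟨i1, i2, i3⟩ := ih h1
    have hinv := hE.inv_state hσ
    have htime : E.time (E.state (σ ++ [r])) = r.release := by rw [state_append, hE.time_step]
    have hlate : ∀ t, r.release ≤ t →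
        E.strategy (σ ++ [r]) t = E.pos (E.state (σ ++ [r])) t := fun t ht =>
      strategy_of_ge fun x hx => (hE.release_le_time hσ x hx).trans (htime.le.trans ht)
    have hearly : ∀ t, t ≤ r.release → E.strategy (σ ++ [r]) t = E.strategy σ t :=
      fun t ht => hE.strategy_append hσ ht
    refine ⟨fun j => by rw [hearly 0 h3, i1], fun s t hs hst j => ?_, fun t ht j => ?_⟩
    · rcases le_total t r.release with ht | ht
      · rw [hearly t ht, hearly s (hst.trans ht)]
        exact i2 s t hs hst j
      rcases le_total r.release s with hs' | hs'
      · rw [hlate t ht, hlate s hs']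
        exact hE.lipschitz _ hinv s t (htime.le.trans hs') hst j
      · have a1 := i2 s r.release hs hs' j
        have a2 := hE.lipschitz _ hinv r.release t htime.le ht j
        rw [← hlate t ht, ← hlate _ le_rfl] at a2
        rw [← hearly s hs', ← hearly _ le_rfl] at a1
        rw [abs_le] at *
        constructor <;> linarith [a1.1, a1.2, a2.1, a2.2]
    · rcases le_total t r.release with ht' | ht'
      · rw [hearly t ht']
        exact i3 t ht j
      · rw [hlate t ht']
        exact hE.mem _ hinv t (htime.le.trans ht') j

theorem Legal.isOnline (hE : E.Legal o L R Inv) : IsOnline o L R E.strategy := by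
  refine ⟨fun σ hσ => hE.isSchedule hσ, fun σ σ' _ _ t _ h => ?_⟩
  simp only [strategy, h]

end EventRule

/-! ### Last release time and lower bounds for the optimum -/

theorem tmax_nonneg (σ : List Request) : 0 ≤ tmax σ := by
  induction σ with
  | nil => simp [tmax]
  | cons r σ ih => exact ih.trans (le_max_right _ _)

theorem release_le_tmax {σ : List Request} : ∀ r ∈ σ, r.release ≤ tmax σ := by
  induction σ with
  | nil => simp
  | cons a σ ih =>
    intro r hr
    rcases List.mem_cons.1 hr with rfl | hr
    · exact le_max_left _ _
    · exact (ih r hr).trans (le_max_right _ _)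

theorem tmax_le {σ : List Request} {T : ℝ} (hT : 0 ≤ T) (h : ∀ r ∈ σ, r.release ≤ T) :
    tmax σ ≤ T := by
  induction σ with
  | nil => simpa [tmax] using hT
  | cons a σ ih =>
    exact max_le (h a (by simp)) (ih fun r hr => h r (by simp [hr]))

theorem EventRule.Legal.time_state {S : Type*} {k : ℕ} {E : EventRule S k} {o L R : ℝ}
    {Inv : S → Prop} (hE : E.Legal o L R Inv) {σ : List Request} (hσ : IsRequestSeq o L R σ) :
    E.time (E.state σ) = tmax σ :=
  le_antisymm (hE.time_state_le (tmax_nonneg σ) release_le_tmax)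
    (tmax_le (hE.time_nonneg hσ) (hE.release_le_time hσ))

theorem cost_le {k : ℕ} {X : Motion k} {σ : List Request} {T : ℝ} (h : AllServedBy X σ T) :
    cost X σ ≤ T :=
  csInf_le ⟨0, fun _ hx => hx.1⟩ h

/-- The last release and the distances to the two extremes bound the completion time from below. -/
theorem AllServedBy.lower_bound {k : ℕ} {o L R : ℝ} {X : Motion k} {σ : List Request} {T : ℝ}
    (hσ : IsRequestSeq o L R σ) (hs : Spans o L R σ) (hX : IsSchedule o L R X)
    (h : AllServedBy X σ T) : max (tmax σ) (max L R) ≤ T := by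
  obtain ⟨hT, h⟩ := h
  have key : ∀ x ∈ insert o {x | ∃ r ∈ σ, r.loc = x}, |x - o| ≤ T := by
    rintro x (rfl | ⟨r, hr, rfl⟩)
    · simpa using hT
    · obtain ⟨t, h1, h2, j, h3⟩ := h r hr
      have ht : 0 ≤ t := (hσ.2 r hr).1.trans h1
      have := hX.2.1 0 t le_rfl ht j
      rw [hX.1 j, h3] at this
      linarith
  refine max_le (tmax_le hT fun r hr => ?_) (max_le ?_ ?_)
  · obtain ⟨t, h1, h2, -⟩ := h r hr
    exact h1.trans h2
  · have := (abs_le.1 (key _ hs.1.1)).1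
    linarith
  · have := (abs_le.1 (key _ hs.2.1)).2
    linarith

/-- The motion `X` only shows that the set of achievable times is nonempty: in ℝ the infimum of the
empty set is 0, and the bound would fail. -/
theorem le_OPT {k : ℕ} {o L R : ℝ} {X : Motion k} {σ : List Request} {T : ℝ}
    (hσ : IsRequestSeq o L R σ) (hs : Spans o L R σ) (hX : IsSchedule o L R X)
    (h : AllServedBy X σ T) : max (tmax σ) (max L R) ≤ OPT k o L R σ :=
  le_csInf ⟨T, X, hX, h⟩ fun _ ⟨_, hY, h'⟩ => h'.lower_bound hσ hs hY

/-! ### A 2-competitive algorithm without locality: late sweeps from both ends -/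

/-- Distance from its end of the segment, at time `t`, of a server that had distance `x` at time
`t₀`, when the last request was released: it returns to the end, waits there, and sweeps half of the
segment so as to complete the sweep at time `2 * max t₀ M`. -/
noncomputable def sweepDepth (M D t₀ x t : ℝ) : ℝ :=
  max (max 0 (x - (t - t₀))) (min (t - 2 * max t₀ M + D / 2) (D / 2))

/-- The rule under which one team of servers sweeps from the left end of the segment to its midpoint
and the other team from the right end, as late as ratio `2` permits. -/
noncomputable def sweepRule {k : ℕ} (side : Fin k → Bool) (o L R : ℝ) :
    EventRule (ℝ × (Fin k → ℝ)) k where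
  init := (0, fun j => if side j then L else R)
  time := Prod.fst
  step P r := (r.release, fun j => sweepDepth (max L R) (L + R) P.1 (P.2 j) r.release)
  pos P t j := if side j then o - L + sweepDepth (max L R) (L + R) P.1 (P.2 j) t
    else o + R - sweepDepth (max L R) (L + R) P.1 (P.2 j) t

/-- The distances are such that every server can return to its end before the next sweep. -/
def SweepInv {k : ℕ} (L R : ℝ) (P : ℝ × (Fin k → ℝ)) : Prop :=
  ∀ j, 0 ≤ P.2 j ∧ P.2 j ≤ L + R ∧ P.2 j ≤ 2 * max P.1 (max L R) - (L + R) / 2 - P.1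

theorem half_add_le_max (L R : ℝ) : (L + R) / 2 ≤ max L R := by
  linarith [le_max_left L R, le_max_right L R]

theorem sweepDepth_self {M D t x : ℝ} (hM : D / 2 ≤ M) (hx : 0 ≤ x) :
    sweepDepth M D t x t = x := by
  have := le_max_left t M
  have := le_max_right t M
  unfold sweepDepth
  rw [sub_self, sub_zero, max_eq_right hx, max_eq_left]
  exact (min_le_left _ _).trans (by linarith)

theorem sweepDepth_lipschitz (M D t₀ x : ℝ) {s t : ℝ} (hst : s ≤ t) :
    |sweepDepth M D t₀ x t - sweepDepth M D t₀ x s| ≤ t - s := by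
  have h1 : |x - (t - t₀) - (x - (s - t₀))| ≤ t - s := by
    rw [abs_le]; constructor <;> linarith
  have h2 : |t - 2 * max t₀ M + D / 2 - (s - 2 * max t₀ M + D / 2)| ≤ t - s := by
    rw [abs_le]; constructor <;> linarith
  have h3 : 0 ≤ t - s := sub_nonneg.2 hst
  refine (abs_max_sub_max_le_max _ _ _ _).trans (max_le ?_ ?_)
  · exact (abs_max_sub_max_le_max _ _ _ _).trans (max_le (by simpa using h3) h1)
  · exact (abs_min_sub_min_le_max _ _ _ _).trans (max_le h2 (by simpa using h3))

theorem sweepDepth_nonneg (M D t₀ x t : ℝ) : 0 ≤ sweepDepth M D t₀ x t :=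
  (le_max_left _ _).trans (le_max_left _ _)

theorem sweepDepth_le {M D t₀ x t : ℝ} (hD : 0 ≤ D) (hx : x ≤ D) (ht : t₀ ≤ t) :
    sweepDepth M D t₀ x t ≤ D :=
  max_le (max_le hD (by linarith)) ((min_le_right _ _).trans (by linarith))

/-- This lets a release at time t interrupt a sweep. The depth reached is at most t - 2 max(t₀, M) +
D/2, and the new slack is large enough because max(t, M) ≥ t and max(t₀, M) ≥ M ≥ D/2. -/
theorem sweepDepth_le_slack {M D t₀ x t : ℝ} (hM : D / 2 ≤ M)
    (hx : x ≤ 2 * max t₀ M - D / 2 - t₀) (ht : t₀ ≤ t) :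
    sweepDepth M D t₀ x t ≤ 2 * max t M - D / 2 - t := by
  have h1 := le_max_left t M
  have h2 := le_max_right t M
  have h3 := le_max_right t₀ M
  have h4 : max t₀ M ≤ max t M := max_le_max_right _ ht
  exact max_le (max_le (by linarith) (by linarith)) ((min_le_left _ _).trans (by linarith))

/-- By the slack bound the return to the end is over when the sweep starts, so from then on the
sweep term alone determines the depth. -/
theorem sweepDepth_reaches {M D t₀ x d : ℝ} (hx : x ≤ 2 * max t₀ M - D / 2 - t₀)
    (hd0 : 0 ≤ d) (hd : d ≤ D / 2) :
    sweepDepth M D t₀ x (2 * max t₀ M - D / 2 + d) = d := by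
  unfold sweepDepth
  rw [min_eq_left (by linarith), max_eq_right]
  · ring
  · exact max_le (by linarith) (by linarith)

theorem sweepRule_legal {k : ℕ} (side : Fin k → Bool) (o : ℝ) {L R : ℝ} (hL : 0 ≤ L)
    (hR : 0 ≤ R) : (sweepRule side o L R).Legal o L R (SweepInv L R) where
  time_init := rfl
  time_step _ _ := rfl
  pos_init j := by
    have h := half_add_le_max L R
    cases hj : side j
    · simp [sweepRule, hj, sweepDepth_self h hR]
    · simp [sweepRule, hj, sweepDepth_self h hL]
  inv_init j := by
    have h1 := le_max_left L R
    have h2 := le_max_right L R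
    have h3 := le_max_right 0 (max L R)
    cases hj : side j <;> simp only [sweepRule, hj, if_true, Bool.false_eq_true, if_false] <;>
      refine ⟨by assumption, by linarith, by linarith⟩
  inv_step P r hP ht _ j := by
    obtain ⟨h0, h1, h2⟩ := hP j
    exact ⟨sweepDepth_nonneg _ _ _ _ _, sweepDepth_le (by linarith) h1 ht,
      sweepDepth_le_slack (half_add_le_max L R) h2 ht⟩
  pos_step P r hP ht := by
    funext j
    have := sweepDepth_self (t := r.release) (half_add_le_max L R)
      (sweepDepth_nonneg (max L R) (L + R) P.1 (P.2 j) r.release)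
    simp only [sweepRule, this]
  lipschitz P hP s t hs hst j := by
    have := sweepDepth_lipschitz (max L R) (L + R) P.1 (P.2 j) hst
    rw [abs_le] at this ⊢
    simp only [sweepRule]
    split_ifs <;> constructor <;> linarith
  mem P hP t ht j := by
    have h0 := sweepDepth_nonneg (max L R) (L + R) P.1 (P.2 j) t
    have h1 : sweepDepth (max L R) (L + R) P.1 (P.2 j) t ≤ L + R :=
      sweepDepth_le (by linarith) (hP j).2.1 ht
    simp only [sweepRule]
    split_ifs <;> constructor <;> linarith

theorem sweepRule_allServedBy {k : ℕ} {side : Fin k → Bool} (hside : Function.Surjective side)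
    {o L R : ℝ} (hL : 0 ≤ L) (hR : 0 ≤ R) {σ : List Request} (hσ : IsRequestSeq o L R σ) :
    AllServedBy ((sweepRule side o L R).strategy σ) σ (2 * max (tmax σ) (max L R)) := by
  have hE := sweepRule_legal side o hL hR
  have htime := hE.time_state hσ
  have hinv := hE.inv_state hσ
  set P := (sweepRule side o L R).state σ
  change P.1 = _ at htime
  have h1 := le_max_left (tmax σ) (max L R)
  have h2 := le_max_right (tmax σ) (max L R)
  have h3 := half_add_le_max L R
  refine ⟨by linarith [tmax_nonneg σ], fun r hr => ?_⟩
  have hloc := (hσ.2 r hr).2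
  have hrel := release_le_tmax r hr
  have key : ∀ j d, 0 ≤ d → d ≤ (L + R) / 2 →
      (if side j then o - L + d else o + R - d) = r.loc →
      ∃ t, r.release ≤ t ∧ t ≤ 2 * max (tmax σ) (max L R) ∧
        ∃ j, (sweepRule side o L R).strategy σ t j = r.loc := by
    intro j d hd0 hd hj
    -- The sweep starts D/2 before its deadline and reaches depth d after a further time d. Since
    -- max(t_max, M) ≥ D/2, it starts no earlier than t_max.
    refine ⟨2 * max (tmax σ) (max L R) - (L + R) / 2 + d, by linarith, by linarith, j, ?_⟩
    rw [EventRule.strategy_of_ge fun x hx => (release_le_tmax x hx).trans (by linarith)]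
    have := sweepDepth_reaches (hinv j).2.2 hd0 hd
    rw [htime] at this
    change (if side j then o - L + sweepDepth _ _ P.1 (P.2 j) _
      else o + R - sweepDepth _ _ P.1 (P.2 j) _) = _
    rw [htime, this, hj]
  rcases le_total r.loc (o - L + (L + R) / 2) with h | h
  · obtain ⟨j, hj⟩ := hside true
    exact key j (r.loc - (o - L)) (by linarith [hloc.1]) (by linarith) (by simp [hj])
  · obtain ⟨j, hj⟩ := hside false
    exact key j (o + R - r.loc) (by linarith [hloc.2]) (by linarith) (by simp [hj])

/-- The sweeping schedule is the feasible schedule that `le_OPT` asks for. -/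
theorem max_le_OPT {k : ℕ} {side : Fin k → Bool} (hside : Function.Surjective side)
    {o L R : ℝ} (hL : 0 ≤ L) (hR : 0 ≤ R) {σ : List Request} (hσ : IsRequestSeq o L R σ)
    (hs : Spans o L R σ) : max (tmax σ) (max L R) ≤ OPT k o L R σ :=
  le_OPT hσ hs ((sweepRule_legal side o hL hR).isSchedule hσ)
    (sweepRule_allServedBy hside hL hR hσ)

theorem sweepRule_isCompetitive {k : ℕ} {side : Fin k → Bool} (hside : Function.Surjective side)
    {o L R : ℝ} (hL : 0 ≤ L) (hR : 0 ≤ R) :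
    IsCompetitive o L R (sweepRule side o L R).strategy 2 := by
  refine ⟨(sweepRule_legal side o hL hR).isOnline, fun σ hσ hs => ?_⟩
  have h := sweepRule_allServedBy hside hL hR hσ
  exact ⟨⟨_, h⟩, (cost_le h).trans (by linarith [max_le_OPT hside hL hR hσ hs])⟩

/-! ### Geometry of a single tour -/

/-- The tour of a server at `p` of the given team, as a function of the time. -/
noncomputable def tour (leftFirst : Bool) (p lo hi s : ℝ) : ℝ :=
  walk p (tourStops leftFirst p lo hi).1 (tourStops leftFirst p lo hi).2 s

theorem moveToward_lipschitz (p q : ℝ) {s t : ℝ} (hst : s ≤ t) :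
    |moveToward p q t - moveToward p q s| ≤ t - s := by
  unfold moveToward
  rw [abs_le]
  constructor <;> simp only [max_def, min_def] <;> split_ifs <;> linarith

theorem moveToward_zero (p q : ℝ) : moveToward p q 0 = p := by
  simp [moveToward]

theorem moveToward_abs (p q : ℝ) : moveToward p q |q - p| = q := by
  unfold moveToward
  rcases abs_cases (q - p) with h | h <;> rw [h.1]
  · rw [min_eq_left (by linarith), max_eq_right (by linarith)]
  · rw [min_eq_left (by linarith), max_eq_right (by linarith)]

theorem moveToward_mem {a b p q s : ℝ} (hs : 0 ≤ s) (hp : p ∈ Set.Icc a b)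
    (hq : q ∈ Set.Icc a b) : moveToward p q s ∈ Set.Icc a b := by
  obtain ⟨h1, h2⟩ := hp
  obtain ⟨h3, h4⟩ := hq
  exact ⟨le_max_of_le_right (le_min h3 (by linarith)),
    max_le (by linarith) ((min_le_left _ _).trans h4)⟩

theorem walk_lipschitz (p a b : ℝ) {s t : ℝ} (hst : s ≤ t) :
    |walk p a b t - walk p a b s| ≤ t - s := by
  unfold walk
  split_ifs with h1 h2 h2
  · exact moveToward_lipschitz _ _ hst
  · exact absurd (hst.trans h1) h2
  · have e1 := moveToward_lipschitz p a h2
    have e2 := moveToward_lipschitz a b (sub_nonneg.2 (not_le.1 h1).le)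
    rw [moveToward_abs] at e1
    rw [moveToward_zero] at e2
    rw [abs_le] at e1 e2 ⊢
    constructor <;> linarith [e1.1, e1.2, e2.1, e2.2]
  · have := moveToward_lipschitz a b (sub_le_sub_right hst |a - p|)
    rwa [sub_sub_sub_cancel_right] at this

theorem tour_lipschitz (c : Bool) (p lo hi : ℝ) {s t : ℝ} (hst : s ≤ t) :
    |tour c p lo hi t - tour c p lo hi s| ≤ t - s :=
  walk_lipschitz _ _ _ hst

/-- Continuity makes the set of visiting times of a point closed, so that first visits exist. -/
theorem tour_continuous (c : Bool) (p lo hi : ℝ) : Continuous (tour c p lo hi) := by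
  have : LipschitzWith 1 (tour c p lo hi) := LipschitzWith.of_dist_le_mul fun s t => by
    rw [Real.dist_eq, Real.dist_eq, NNReal.coe_one, one_mul]
    rcases le_total s t with h | h
    · rw [abs_sub_comm, abs_sub_comm s, abs_of_nonneg (sub_nonneg.2 h)]
      exact tour_lipschitz c p lo hi h
    · rw [abs_of_nonneg (sub_nonneg.2 h)]
      exact tour_lipschitz c p lo hi h
  exact this.continuous

theorem tour_zero (c : Bool) (p lo hi : ℝ) : tour c p lo hi 0 = p := by
  simp [tour, walk, moveToward_zero]

theorem tour_mem {a b : ℝ} (c : Bool) {p lo hi s : ℝ} (hs : 0 ≤ s) (hp : p ∈ Set.Icc a b)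
    (hlo : lo ∈ Set.Icc a b) (hhi : hi ∈ Set.Icc a b) : tour c p lo hi s ∈ Set.Icc a b := by
  have h1 : (tourStops c p lo hi).1 ∈ Set.Icc a b := by
    unfold tourStops; split_ifs <;> assumption
  have h2 : (tourStops c p lo hi).2 ∈ Set.Icc a b := by
    unfold tourStops; split_ifs <;> assumption
  unfold tour walk
  split_ifs with h
  · exact moveToward_mem hs hp h1
  · exact moveToward_mem (by linarith) h1 h2

theorem tour_of_hi_le (c : Bool) {p lo hi s : ℝ} (hlh : lo ≤ hi) (h : hi ≤ p) (hs : 0 ≤ s) :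
    tour c p lo hi s = max (p - s) lo := by
  have e : |lo - p| = p - lo := by rw [abs_of_nonpos (by linarith)]; ring
  simp only [tour, tourStops, h, if_true, walk, e, moveToward]
  simp only [max_def, min_def]
  split_ifs <;> linarith

theorem tour_of_le_lo (c : Bool) {p lo hi s : ℝ} (hlh : lo ≤ hi) (h : p ≤ lo) (hs : 0 ≤ s) :
    tour c p lo hi s = min (p + s) hi := by
  -- `tourStops` tests `hi ≤ p` first, so the degenerate case lo = hi = p belongs to the previous
  -- lemma.
  rcases le_or_gt hi p with h' | h'
  · rw [tour_of_hi_le c hlh h' hs]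
    simp only [max_def, min_def]
    split_ifs <;> linarith
  · have e : |hi - p| = hi - p := abs_of_nonneg (by linarith)
    simp only [tour, tourStops, not_le.2 h', h, if_true, if_false, walk, e, moveToward]
    simp only [max_def, min_def]
    split_ifs <;> linarith

/-- Before it has reached the left extreme, a left-first server moves to the left. -/
theorem tour_true_early {p lo hi s : ℝ} (h : p < hi) (hs : 0 ≤ s)
    (hs' : s ≤ max 0 (p - lo)) : tour true p lo hi s = p - s := by
  rcases le_or_gt p lo with h' | h'
  · rw [max_eq_left (by linarith)] at hs'
    obtain rfl : s = 0 := le_antisymm hs' hs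
    rw [tour_zero, sub_zero]
  · rw [max_eq_right (by linarith)] at hs'
    have e : |lo - p| = p - lo := by rw [abs_of_nonpos (by linarith)]; ring
    simp only [tour, tourStops, not_le.2 h, not_le.2 h', if_true, if_false, walk, e, moveToward, hs']
    rw [max_eq_left (min_le_of_left_le (by linarith))]

/-- From then on, a left-first server moves to the right extreme. -/
theorem tour_true_late {p lo hi s : ℝ} (hlh : lo ≤ hi) (h : p < hi)
    (hs : max 0 (p - lo) ≤ s) :
    tour true p lo hi s = min (min lo p + (s - max 0 (p - lo))) hi := by
  rcases le_or_gt p lo with h' | h'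
  · rw [max_eq_left (by linarith)] at hs ⊢
    rw [tour_of_le_lo true hlh h' hs, min_eq_right h', sub_zero]
  · rw [max_eq_right (by linarith)] at hs ⊢
    have e : |lo - p| = p - lo := by rw [abs_of_nonpos (by linarith)]; ring
    simp only [tour, tourStops, not_le.2 h, not_le.2 h', if_true, if_false, walk, e, moveToward]
    simp only [max_def, min_def]
    split_ifs <;> linarith

theorem moveToward_neg (p q : ℝ) {s : ℝ} (hs : 0 ≤ s) :
    moveToward (-p) (-q) s = -moveToward p q s := by
  unfold moveToward
  simp only [max_def, min_def]
  split_ifs <;> linarith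

theorem walk_neg (p a b : ℝ) {s : ℝ} (hs : 0 ≤ s) : walk (-p) (-a) (-b) s = -walk p a b s := by
  have e : |-a - -p| = |a - p| := by rw [← abs_neg]; congr 1; ring
  unfold walk
  rw [e]
  split_ifs with h
  · exact moveToward_neg p a hs
  · exact moveToward_neg a b (by linarith)

/-- The reflection of the line exchanges the two teams. -/
theorem tour_false_eq_neg {p lo hi s : ℝ} (hlh : lo ≤ hi) (hs : 0 ≤ s) :
    tour false p lo hi s = -tour true (-p) (-hi) (-lo) s := by
  rcases le_or_gt hi p with h | h
  · rw [tour_of_hi_le _ hlh h hs, tour_of_le_lo _ (by linarith) (by linarith) hs,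
      ← max_neg_neg]
    congr 1 <;> ring
  rcases le_or_gt p lo with h' | h'
  · rw [tour_of_le_lo _ hlh h' hs, tour_of_hi_le _ (by linarith) (by linarith) hs,
      ← min_neg_neg]
    congr 1 <;> ring
  · simp only [tour, tourStops, not_le.2 h, not_le.2 h', neg_le_neg_iff, if_false, if_true,
      Bool.false_eq_true]
    rw [walk_neg _ _ _ hs, neg_neg]

/-- A left-first server passes all points between the extremes up to its position on its way to
the right. -/
theorem tour_true_passed {p lo hi s e : ℝ} (h : p < hi) (hlo : lo ≤ e) (hhi : e ≤ hi)
    (he : e ≤ min lo p + (s - max 0 (p - lo))) :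
    ∃ u, 0 ≤ u ∧ u ≤ s ∧ tour true p lo hi u = e := by
  have h0 := le_max_left 0 (p - lo)
  have h1 := min_le_left lo p
  refine ⟨max 0 (p - lo) + (e - min lo p), by linarith, by linarith, ?_⟩
  rw [tour_true_late (hlo.trans hhi) h (by linarith), min_eq_left (by linarith)]
  ring

theorem tour_true_covers {p lo hi e : ℝ} (h : hi ≤ p) (hlo : lo ≤ e) (hhi : e ≤ hi) :
    tour true p lo hi (p - e) = e := by
  rw [tour_of_hi_le true (hlo.trans hhi) h (by linarith), max_eq_left (by linarith)]
  ring

theorem tour_false_passed {q lo hi s e : ℝ} (h : lo < q) (hlo : lo ≤ e) (hhi : e ≤ hi)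
    (he : max hi q - (s - max 0 (hi - q)) ≤ e) :
    ∃ u, 0 ≤ u ∧ u ≤ s ∧ tour false q lo hi u = e := by
  have e1 : -q - -hi = hi - q := by ring
  have e2 : min (-hi) (-q) = -max hi q := min_neg_neg _ _
  obtain ⟨u, h0, h1, h2⟩ := tour_true_passed (p := -q) (lo := -hi) (hi := -lo) (s := s) (e := -e)
    (by linarith) (by linarith) (by linarith) (by rw [e1, e2]; linarith)
  exact ⟨u, h0, h1, by rw [tour_false_eq_neg (hlo.trans hhi) h0, h2, neg_neg]⟩

/-! ### Two opposite tours: covering, crossing, points left behind -/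

/-- Two servers, one of each team and the left-first one on the left, together pass every
point between the extremes soon. -/
theorem tours_cover {a b M Δ p q lo hi e : ℝ} (hΔ : 0 ≤ Δ) (hM : b - a ≤ 2 * M)
    (hp : a ≤ p) (hq : q ≤ b) (halo : a ≤ lo) (hhib : hi ≤ b) (hpq : p ≤ q)
    (hlo : p - Δ ≤ lo) (hhi : hi ≤ q + Δ) (h1 : lo ≤ e) (h2 : e ≤ hi) :
    ∃ u, 0 ≤ u ∧ u ≤ Δ + M ∧ (tour true p lo hi u = e ∨ tour false q lo hi u = e) := by
  have hM0 : 0 ≤ M := by linarith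
  -- If all extremes lie on one outer side of a server, it meets every point between them within Δ,
  -- without turning.
  rcases le_or_gt hi p with h | h
  · exact ⟨p - e, by linarith, by linarith, Or.inl (tour_true_covers h h1 h2)⟩
  rcases le_or_gt q lo with h' | h'
  · refine ⟨e - q, by linarith, by linarith, Or.inr ?_⟩
    rw [tour_of_le_lo false (h1.trans h2) h' (by linarith), min_eq_left (by linarith)]
    ring
  have ha : max 0 (p - lo) ≤ Δ := max_le hΔ (by linarith)
  have hb : max 0 (hi - q) ≤ Δ := max_le hΔ (by linarith)
  have hl : a ≤ min lo p := le_min halo hp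
  have hr : max hi q ≤ b := max_le hhib hq
  -- Each server turns by time Δ. In the remaining time M the left-first one has come at least to
  -- min(lo, p) + M ≥ a + M and the right-first one down to max(hi, q) - M ≤ b - M, and b - M ≤ a +
  -- M.
  rcases le_total e (min lo p + M) with he | he
  · obtain ⟨u, u0, u1, u2⟩ := tour_true_passed (s := Δ + M) h h1 h2 (by linarith)
    exact ⟨u, u0, u1, Or.inl u2⟩
  · obtain ⟨u, u0, u1, u2⟩ := tour_false_passed (s := Δ + M) h' h1 h2 (by linarith)
    exact ⟨u, u0, u1, Or.inr u2⟩

/-- Two such servers do not cross before all points between the extremes have been passed. -/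
theorem tours_crossed {p q lo hi s : ℝ} (hpq : p ≤ q) (hlh : lo ≤ hi) (hs : 0 ≤ s)
    (hcross : tour false q lo hi s < tour true p lo hi s) :
    ∃ s', 0 ≤ s' ∧ s' < s ∧ ∀ e, lo ≤ e → e ≤ hi →
      ∃ u, 0 ≤ u ∧ u ≤ s' ∧ (tour true p lo hi u = e ∨ tour false q lo hi u = e) := by
  rcases le_or_gt hi p with h | h
  · rw [tour_of_hi_le _ hlh h hs, tour_of_hi_le _ hlh (h.trans hpq) hs] at hcross
    exact absurd (max_le_max_right lo (by linarith : p - s ≤ q - s)) (not_le.2 hcross)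
  rcases le_or_gt q lo with h' | h'
  · rw [tour_of_le_lo _ hlh h' hs, tour_of_le_lo _ hlh (hpq.trans h') hs] at hcross
    exact absurd (min_le_min_right hi (by linarith : p + s ≤ q + s)) (not_le.2 hcross)
  have lipP := abs_le.1 (tour_lipschitz true p lo hi hs)
  have lipQ := abs_le.1 (tour_lipschitz false q lo hi hs)
  rw [tour_zero] at lipP lipQ
  -- Before its turn a server moves away from the other at full speed, so they cannot have crossed;
  -- hence both have turned before s.
  have ha : max 0 (p - lo) < s := by
    by_contra hcon
    rw [tour_true_early h hs (not_lt.1 hcon)] at hcross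
    linarith [lipQ.1]
  have hb : max 0 (hi - q) < s := by
    by_contra hcon
    have e1 : -q - -hi = hi - q := by ring
    rw [tour_false_eq_neg hlh hs, tour_true_early (by linarith) hs
      (by rw [e1]; exact not_lt.1 hcon)] at hcross
    linarith [lipP.2]
  set g := tour true p lo hi s - tour false q lo hi s with hg
  -- At speed at most 1, going back by at most g/2 undoes at most the overlap g. So at this earlier
  -- time both servers have turned, and the left-first one is still not left of the other.
  have hs'lt : max (max (max 0 (p - lo)) (max 0 (hi - q))) (s - g / 2) < s :=
    max_lt (max_lt ha hb) (by linarith)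
  set s' := max (max (max 0 (p - lo)) (max 0 (hi - q))) (s - g / 2)
  have ha' : max 0 (p - lo) ≤ s' := (le_max_left _ _).trans (le_max_left _ _)
  have hb' : max 0 (hi - q) ≤ s' := (le_max_right _ _).trans (le_max_left _ _)
  have hg' : s - g / 2 ≤ s' := le_max_right _ _
  have hs'0 : 0 ≤ s' := (le_max_left _ _).trans ha'
  have lP := abs_le.1 (tour_lipschitz true p lo hi hs'lt.le)
  have lQ := abs_le.1 (tour_lipschitz false q lo hi hs'lt.le)
  have hP : tour true p lo hi s' ≤ min lo p + (s' - max 0 (p - lo)) := by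
    rw [tour_true_late hlh h ha']
    exact min_le_left _ _
  have hQ : max hi q - (s' - max 0 (hi - q)) ≤ tour false q lo hi s' := by
    have e1 : -q - -hi = hi - q := by ring
    rw [tour_false_eq_neg hlh hs'0, tour_true_late (by linarith) (by linarith) (by rwa [e1]), e1,
      min_neg_neg hi q]
    have := min_le_left (-max hi q + (s' - max 0 (hi - q))) (-lo)
    linarith
  refine ⟨s', hs'0, hs'lt, fun e h1 h2 => ?_⟩
  rcases le_total e (tour true p lo hi s') with he | he
  · obtain ⟨u, u0, u1, u2⟩ := tour_true_passed h h1 h2 (he.trans hP)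
    exact ⟨u, u0, u1, Or.inl u2⟩
  · obtain ⟨u, u0, u1, u2⟩ := tour_false_passed (s := s') h' h1 h2
      (by linarith [lP.2, lP.1, lQ.1, lQ.2])
    exact ⟨u, u0, u1, Or.inr u2⟩

/-- A left-first server leaves no point that it has not passed far behind on its left. -/
theorem tour_true_le_of_not_passed {Δ p lo hi s e : ℝ} (hΔ : 0 ≤ Δ) (hs : 0 ≤ s) (h1 : lo ≤ e)
    (h2 : e ≤ hi) (he : p - Δ ≤ e)
    (hpass : ∀ u, 0 ≤ u → u ≤ s → tour true p lo hi u ≠ e) :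
    tour true p lo hi s - Δ ≤ e := by
  have hlh := h1.trans h2
  rcases le_or_gt hi p with h | h
  · rw [tour_of_hi_le true hlh h hs]
    have : max (p - s) lo ≤ p := max_le (by linarith) (by linarith)
    linarith
  rcases le_total s (max 0 (p - lo)) with ha | ha
  · rw [tour_true_early h hs ha]
    linarith
  -- After the turn, everything from lo up to the current position has been passed, so an unpassed
  -- point lies ahead.
  · by_contra hcon
    obtain ⟨u, u0, u1, u2⟩ := tour_true_passed (s := s) h h1 h2 (by
      have := min_le_left (min lo p + (s - max 0 (p - lo))) hi
      rw [← tour_true_late hlh h ha] at this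
      linarith)
    exact hpass u u0 u1 u2

theorem le_tour_false_of_not_passed {Δ q lo hi s e : ℝ} (hΔ : 0 ≤ Δ) (hs : 0 ≤ s) (h1 : lo ≤ e)
    (h2 : e ≤ hi) (he : e ≤ q + Δ)
    (hpass : ∀ u, 0 ≤ u → u ≤ s → tour false q lo hi u ≠ e) :
    e ≤ tour false q lo hi s + Δ := by
  have hlh := h1.trans h2
  have := tour_true_le_of_not_passed (Δ := Δ) (p := -q) (lo := -hi) (hi := -lo) (s := s) (e := -e)
    hΔ hs (by linarith) (by linarith) (by linarith) fun u u0 u1 hu =>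
      hpass u u0 u1 (by rw [tour_false_eq_neg hlh u0, hu, neg_neg])
  rw [tour_false_eq_neg hlh hs]
  linarith

/-! ### The algorithm P as an event-driven rule -/

/-- The rule of the parallelized two-extremes algorithm. -/
noncomputable def parallelRule {k : ℕ} (side : Fin k → Bool) (o : ℝ) :
    EventRule (ℝ × ServerState k) k where
  init := (0, { pos := fun _ => o, out := ∅ })
  time := Prod.fst
  step P r := (r.release, { pos := (P.2.advance side (r.release - P.1)).pos,
                            out := insert r.loc (P.2.advance side (r.release - P.1)).out })
  pos P t := (P.2.advance side (t - P.1)).pos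

theorem parallelTour_eq {k : ℕ} (side : Fin k → Bool) (o : ℝ) :
    parallelTour side o = (parallelRule side o).strategy := rfl

namespace ServerState

variable {k : ℕ} {side : Fin k → Bool} {S : ServerState k}

theorem advance_pos (s : ℝ) (j : Fin k) : (S.advance side s).pos j =
    tour (side j) (S.pos j) (sInf (S.out : Set ℝ)) (sSup (S.out : Set ℝ))
      (min s (S.clearTime side)) := rfl

theorem sInf_le_of_mem {e : ℝ} (he : e ∈ S.out) : sInf (S.out : Set ℝ) ≤ e :=
  csInf_le S.out.finite_toSet.bddBelow he

theorem le_sSup_of_mem {e : ℝ} (he : e ∈ S.out) : e ≤ sSup (S.out : Set ℝ) :=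
  le_csSup S.out.finite_toSet.bddAbove he

theorem sInf_mem (h : S.out.Nonempty) : sInf (S.out : Set ℝ) ∈ S.out :=
  Set.Nonempty.csInf_mem (s := (S.out : Set ℝ)) h S.out.finite_toSet

theorem sSup_mem (h : S.out.Nonempty) : sSup (S.out : Set ℝ) ∈ S.out :=
  Set.Nonempty.csSup_mem (s := (S.out : Set ℝ)) h S.out.finite_toSet

theorem clearTime_nonneg : 0 ≤ S.clearTime side :=
  Real.sInf_nonneg fun _ h => h.1

/-- With nothing outstanding, the extremes have the default value 0 and the tours are meaningless;
clear time 0 keeps the servers in place. -/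
theorem clearTime_of_empty (h : S.out = ∅) : S.clearTime side = 0 :=
  le_antisymm (csInf_le ⟨0, fun _ h => h.1⟩ ⟨le_rfl, by simp [h]⟩) clearTime_nonneg

theorem advance_pos_zero : (S.advance side 0).pos = S.pos := by
  funext j
  rw [advance_pos, min_eq_left clearTime_nonneg, tour_zero]

theorem advance_pos_lipschitz {s t : ℝ} (hst : s ≤ t) (j : Fin k) :
    |(S.advance side t).pos j - (S.advance side s).pos j| ≤ t - s := by
  rw [advance_pos, advance_pos]
  refine (tour_lipschitz _ _ _ _ (min_le_min_right _ hst)).trans ?_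
  simp only [min_def]
  split_ifs <;> linarith

theorem advance_pos_mem {a b s : ℝ} (hpos : ∀ j, S.pos j ∈ Set.Icc a b)
    (hout : ∀ e ∈ S.out, e ∈ Set.Icc a b) (hs : 0 ≤ s) (j : Fin k) :
    (S.advance side s).pos j ∈ Set.Icc a b := by
  rw [advance_pos]
  rcases S.out.eq_empty_or_nonempty with h | h
  · rw [clearTime_of_empty h, min_eq_right hs, tour_zero]
    exact hpos j
  · exact tour_mem _ (le_min hs clearTime_nonneg) (hpos j) (hout _ (sInf_mem h))
      (hout _ (sSup_mem h))

theorem mem_advance_out {s e : ℝ} :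
    e ∈ (S.advance side s).out ↔ e ∈ S.out ∧ ¬ S.Visits side s e := by
  simp [advance]

end ServerState

/-- All servers and all outstanding requests are on the segment. -/
def OnSegment {k : ℕ} (o L R : ℝ) (P : ℝ × ServerState k) : Prop :=
  (∀ j, P.2.pos j ∈ Set.Icc (o - L) (o + R)) ∧ ∀ e ∈ P.2.out, e ∈ Set.Icc (o - L) (o + R)

theorem parallelRule_legal {k : ℕ} (side : Fin k → Bool) (o : ℝ) {L R : ℝ} (hL : 0 ≤ L)
    (hR : 0 ≤ R) : (parallelRule side o).Legal o L R (OnSegment o L R) where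
  time_init := rfl
  time_step _ _ := rfl
  pos_init j := by
    simp only [parallelRule, sub_zero, ServerState.advance_pos_zero]
  inv_init := ⟨fun _ => ⟨by simpa [parallelRule] using hL, by simpa [parallelRule] using hR⟩,
    by simp [parallelRule]⟩
  inv_step P r hP ht hr := by
    refine ⟨ServerState.advance_pos_mem hP.1 hP.2 (sub_nonneg.2 ht), fun e he => ?_⟩
    rcases Finset.mem_insert.1 he with rfl | he
    · exact hr
    · exact hP.2 e (ServerState.mem_advance_out.1 he).1
  pos_step P r _ _ := by
    simp only [parallelRule, sub_self, ServerState.advance_pos_zero]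
  lipschitz P _ s t _ hst j := by
    have := ServerState.advance_pos_lipschitz (S := P.2) (side := side)
      (sub_le_sub_right hst P.1) j
    rwa [sub_sub_sub_cancel_right] at this
  mem P hP t ht j := ServerState.advance_pos_mem hP.1 hP.2 (sub_nonneg.2 ht) j

/-! ### The invariant of the two teams -/

/-- The left-first servers are at `p` and the right-first servers at `q`, not left of `p`, and the
outstanding requests are not further than `Δ` outside of the interval between them. -/
structure Teams {k : ℕ} (side : Fin k → Bool) (Δ p q : ℝ) (S : ServerState k) : Prop where
  le : p ≤ q
  pos : ∀ j, S.pos j = if side j then p else q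
  out : ∀ e ∈ S.out, p - Δ ≤ e ∧ e ≤ q + Δ

namespace Teams

variable {k : ℕ} {side : Fin k → Bool} {S : ServerState k} {Δ p q : ℝ}

theorem onTour (h : Teams side Δ p q S) (j : Fin k) (s : ℝ) : S.onTour side j s =
    if side j then tour true p (sInf (S.out : Set ℝ)) (sSup (S.out : Set ℝ)) s
    else tour false q (sInf (S.out : Set ℝ)) (sSup (S.out : Set ℝ)) s := by
  change tour (side j) (S.pos j) _ _ s = _
  rw [h.pos j]
  cases side j <;> simp

theorem visits_iff (h : Teams side Δ p q S) (hside : Function.Surjective side) (s e : ℝ) :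
    S.Visits side s e ↔ ∃ u, 0 ≤ u ∧ u ≤ s ∧
      (tour true p (sInf (S.out : Set ℝ)) (sSup (S.out : Set ℝ)) u = e ∨
        tour false q (sInf (S.out : Set ℝ)) (sSup (S.out : Set ℝ)) u = e) := by
  constructor
  · rintro ⟨j, u, h0, h1, h2⟩
    rw [h.onTour] at h2
    refine ⟨u, h0, h1, ?_⟩
    cases hj : side j
    · exact Or.inr (by simpa [hj] using h2)
    · exact Or.inl (by simpa [hj] using h2)
  · rintro ⟨u, h0, h1, h2 | h2⟩
    · obtain ⟨j, hj⟩ := hside true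
      exact ⟨j, u, h0, h1, by rw [h.onTour, hj]; simpa using h2⟩
    · obtain ⟨j, hj⟩ := hside false
      exact ⟨j, u, h0, h1, by rw [h.onTour, hj]; simpa using h2⟩

/-- M stays free: max{L, R} yields the cost bound, while the length of the segment suffices to show
that the clear time is a genuine infimum. -/
theorem visits_of_mem (h : Teams side Δ p q S) (hside : Function.Surjective side) (hΔ : 0 ≤ Δ)
    {a b M : ℝ} (hM : b - a ≤ 2 * M) (hpos : ∀ j, S.pos j ∈ Set.Icc a b)
    (hout : ∀ e ∈ S.out, e ∈ Set.Icc a b) {e : ℝ} (he : e ∈ S.out) :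
    S.Visits side (Δ + M) e := by
  rw [h.visits_iff hside]
  have hne : S.out.Nonempty := ⟨e, he⟩
  obtain ⟨i, hi⟩ := hside true
  obtain ⟨j, hj⟩ := hside false
  have hp := hpos i
  have hq := hpos j
  rw [h.pos, hi] at hp
  rw [h.pos, hj] at hq
  exact tours_cover hΔ hM hp.1 hq.2 (hout _ (ServerState.sInf_mem hne)).1
    (hout _ (ServerState.sSup_mem hne)).2 h.le (h.out _ (ServerState.sInf_mem hne)).1
    (h.out _ (ServerState.sSup_mem hne)).2 (ServerState.sInf_le_of_mem he)
    (ServerState.le_sSup_of_mem he)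

end Teams

theorem ServerState.onTour_continuous {k : ℕ} (side : Fin k → Bool) (S : ServerState k)
    (j : Fin k) : Continuous (S.onTour side j) :=
  tour_continuous _ _ _ _

/-- The clear time is attained: every outstanding request that is visited at all is visited by
then, provided that all of them are visited at some time. -/
theorem ServerState.visits_clearTime {k : ℕ} {side : Fin k → Bool} {S : ServerState k} {T : ℝ}
    (hT : 0 ≤ T) (hvis : ∀ e ∈ S.out, S.Visits side T e) {e : ℝ} (he : e ∈ S.out) :
    S.Visits side (S.clearTime side) e := by
  -- The first visit to e is attained, as the visiting times form a finite union of closed sets. It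
  -- precedes every time by which all requests are visited, hence also their infimum.
  have hclosed : IsClosed (⋃ j, {u | 0 ≤ u ∧ S.onTour side j u = e}) := by
    refine isClosed_iUnion_of_finite fun j => ?_
    exact isClosed_Ici.inter (isClosed_eq (S.onTour_continuous side j) continuous_const)
  have hbdd : BddBelow (⋃ j, {u | 0 ≤ u ∧ S.onTour side j u = e}) := by
    refine ⟨0, fun u hu => ?_⟩
    obtain ⟨j, hj⟩ := Set.mem_iUnion.1 hu
    exact hj.1
  have hne : (⋃ j, {u | 0 ≤ u ∧ S.onTour side j u = e}).Nonempty := by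
    obtain ⟨j, u, h0, _, h2⟩ := hvis e he
    exact ⟨u, Set.mem_iUnion.2 ⟨j, h0, h2⟩⟩
  obtain ⟨j, h0, h1⟩ := Set.mem_iUnion.1 (hclosed.csInf_mem hne hbdd)
  refine ⟨j, _, h0, ?_, h1⟩
  refine le_csInf ⟨T, hT, hvis⟩ fun s hs => ?_
  obtain ⟨j, u, h0, h1, h2⟩ := hs.2 e he
  exact (csInf_le hbdd (Set.mem_iUnion.2 ⟨j, h0, h2⟩)).trans h1

namespace Teams

variable {k : ℕ} {side : Fin k → Bool} {S : ServerState k} {Δ p q : ℝ}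

theorem visits_clearTime (h : Teams side Δ p q S) (hside : Function.Surjective side)
    (hΔ : 0 ≤ Δ) {a b : ℝ} (hpos : ∀ j, S.pos j ∈ Set.Icc a b)
    (hout : ∀ e ∈ S.out, e ∈ Set.Icc a b) {e : ℝ} (he : e ∈ S.out) :
    S.Visits side (S.clearTime side) e := by
  have hab := (hout e he).1.trans (hout e he).2
  refine ServerState.visits_clearTime (T := Δ + (b - a)) (by linarith) (fun e' he' => ?_) he
  exact h.visits_of_mem hside hΔ (by linarith) hpos hout he'

/-- A request visited on the tours is visited by the actual motion. -/
theorem visits_min_clearTime (h : Teams side Δ p q S) (hside : Function.Surjective side)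
    (hΔ : 0 ≤ Δ) {a b : ℝ} (hpos : ∀ j, S.pos j ∈ Set.Icc a b)
    (hout : ∀ e ∈ S.out, e ∈ Set.Icc a b) {s e : ℝ} (he : e ∈ S.out)
    (hv : S.Visits side s e) : ∃ u, 0 ≤ u ∧ u ≤ s ∧ ∃ j, (S.advance side u).pos j = e := by
  have : ∃ j, ∃ u, 0 ≤ u ∧ u ≤ min s (S.clearTime side) ∧ S.onTour side j u = e := by
    rcases le_total s (S.clearTime side) with hs | hs
    · rw [min_eq_left hs]
      exact hv
    · rw [min_eq_right hs]
      exact h.visits_clearTime hside hΔ hpos hout he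
  obtain ⟨j, u, h0, h1, h2⟩ := this
  refine ⟨u, h0, h1.trans (min_le_left _ _), j, ?_⟩
  rw [ServerState.advance_pos, min_eq_left (h1.trans (min_le_right _ _))]
  exact h2

/-- The position of the two teams is preserved while the servers follow their tours. -/
theorem advance (h : Teams side Δ p q S) (hside : Function.Surjective side)
    (hΔ : 0 ≤ Δ) {a b : ℝ} (hpos : ∀ j, S.pos j ∈ Set.Icc a b)
    (hout : ∀ e ∈ S.out, e ∈ Set.Icc a b) {s : ℝ} (hs : 0 ≤ s) :
    ∃ p' q', Teams side Δ p' q' (S.advance side s) := by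
  set lo := sInf (S.out : Set ℝ) with hlo
  set hi := sSup (S.out : Set ℝ) with hhi
  set u := min s (S.clearTime side) with hu
  have hu0 : 0 ≤ u := le_min hs ServerState.clearTime_nonneg
  -- The servers stop at the clear time, whereas `out` is filtered with the full time s. If they
  -- have stopped, nothing is left, so remaining requests force u = s.
  have hempty : s > u → ∀ e, e ∉ (S.advance side s).out := by
    intro hsu e he
    obtain ⟨h1, h2⟩ := ServerState.mem_advance_out.1 he
    have hc : S.clearTime side ≤ s := by
      by_contra hcon
      rw [hu, min_eq_left (not_le.1 hcon).le] at hsu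
      exact lt_irrefl _ hsu
    obtain ⟨j, v, v0, v1, v2⟩ := h.visits_clearTime hside hΔ hpos hout h1
    exact h2 ⟨j, v, v0, v1.trans hc, v2⟩
  refine ⟨tour true p lo hi u, tour false q lo hi u, ?_, fun j => h.onTour j u, fun e he => ?_⟩
  · rcases S.out.eq_empty_or_nonempty with he | hne
    · rw [hu, ServerState.clearTime_of_empty he, min_eq_right hs, tour_zero, tour_zero]
      exact h.le
    · by_contra hcon
      have hlh : lo ≤ hi := ServerState.le_sSup_of_mem (ServerState.sInf_mem hne)
      -- A crossing by time u would put the clear time strictly before u, but u is at most the clear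
      -- time.
      obtain ⟨s', h0, h1, h2⟩ := tours_crossed h.le hlh hu0 (not_le.1 hcon)
      have : S.clearTime side ≤ s' := csInf_le ⟨0, fun _ h => h.1⟩ ⟨h0, fun e he =>
        (h.visits_iff hside s' e).2
          (h2 e (ServerState.sInf_le_of_mem he) (ServerState.le_sSup_of_mem he))⟩
      linarith [min_le_right s (S.clearTime side)]
  · obtain ⟨h1, h2⟩ := ServerState.mem_advance_out.1 he
    have hsu : u = s := by
      by_contra hcon
      exact hempty (lt_of_le_of_ne (min_le_left _ _) hcon) e he
    rw [h.visits_iff hside] at h2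
    push Not at h2
    rw [hsu]
    exact ⟨tour_true_le_of_not_passed hΔ hs (ServerState.sInf_le_of_mem h1)
        (ServerState.le_sSup_of_mem h1) (h.out e h1).1 fun v v0 v1 => (h2 v v0 v1).1,
      le_tour_false_of_not_passed hΔ hs (ServerState.sInf_le_of_mem h1)
        (ServerState.le_sSup_of_mem h1) (h.out e h1).2 fun v v0 v1 => (h2 v v0 v1).2⟩

end Teams

/-! ### Cost of P under locality and the competitive ratios -/

/-- Under spatial locality, after every release the teams are in position and every request is
outstanding or has been served. -/
theorem parallelRule_teams {k : ℕ} {side : Fin k → Bool} (hside : Function.Surjective side)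
    {o L R Δ : ℝ} (hL : 0 ≤ L) (hR : 0 ≤ R) (hΔ : 0 ≤ Δ) {σ : List Request}
    (hσ : IsRequestSeq o L R σ)
    (hloc : SpatialLocality Δ ((parallelRule side o).strategy σ) σ) :
    (∃ p q, Teams side Δ p q ((parallelRule side o).state σ).2) ∧
    ∀ r ∈ σ, r.loc ∈ ((parallelRule side o).state σ).2.out ∨
      ∃ t, r.release ≤ t ∧ t ≤ ((parallelRule side o).state σ).1 ∧
        ∃ j, (parallelRule side o).strategy σ t j = r.loc := by
  have hE := parallelRule_legal side o hL hR
  induction σ using List.reverseRecOn with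
  | nil =>
    refine ⟨⟨o, o, le_rfl, fun j => ?_, ?_⟩, by simp⟩
    · simp [parallelRule, EventRule.state]
    · simp [parallelRule, EventRule.state]
  | append_singleton σ r ih =>
    obtain ⟨h1, h2, h3, h4⟩ := hσ.of_append
    have hearly : ∀ t, t ≤ r.release →
        (parallelRule side o).strategy (σ ++ [r]) t = (parallelRule side o).strategy σ t :=
      fun t ht => hE.strategy_append hσ ht
    have hloc' : SpatialLocality Δ ((parallelRule side o).strategy σ) σ := by
      intro x hx
      rw [← hearly _ (h2 x hx)]
      exact hloc x (by simp [hx])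
    obtain ⟨⟨p, q, hT⟩, hserved⟩ := ih h1 hloc'
    obtain ⟨i1, i2⟩ := hE.inv_state h1
    have htime : ((parallelRule side o).state σ).1 ≤ r.release := hE.time_state_le h3 h2
    have htime' := hE.release_le_time h1
    have hpos : ∀ t, (∀ x ∈ σ, x.release ≤ t) → (parallelRule side o).strategy σ t =
        (((parallelRule side o).state σ).2.advance side
          (t - ((parallelRule side o).state σ).1)).pos :=
      fun t ht => EventRule.strategy_of_ge ht
    rw [EventRule.state_append]
    set P := (parallelRule side o).state σ
    change ∀ x ∈ σ, x.release ≤ P.1 at htime'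
    have hs : 0 ≤ r.release - P.1 := sub_nonneg.2 htime
    obtain ⟨p', q', hT'⟩ := hT.advance hside hΔ i1 i2 hs
    refine ⟨⟨p', q', hT'.le, hT'.pos, fun e he => ?_⟩, fun x hx => ?_⟩
    · rcases Finset.mem_insert.1 he with rfl | he
      -- Locality enters the invariant here: the new request is within Δ of p' or of q', hence
      -- within Δ of the interval between them.
      · obtain ⟨j, hj⟩ := hloc r (by simp)
        rw [hearly _ le_rfl, hpos _ h2, hT'.pos j, abs_le] at hj
        have := hT'.le
        split_ifs at hj <;> constructor <;> linarith [hj.1, hj.2]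
      · exact hT'.out e he
    · rcases List.mem_append.1 hx with hx | hx
      · rcases hserved x hx with hout | ⟨t, t1, t2, j, hj⟩
        · by_cases hv : P.2.Visits side (r.release - P.1) x.loc
          · obtain ⟨u, u0, u1, j, hj⟩ := hT.visits_min_clearTime hside hΔ i1 i2 hout hv
            have hxP := htime' x hx
            refine Or.inr ⟨P.1 + u, by linarith, ?_, j, ?_⟩
            · change P.1 + u ≤ r.release
              linarith
            · rw [hearly _ (by linarith), hpos _ fun y hy => (htime' y hy).trans (by linarith),
                add_sub_cancel_left, hj]
          · exact Or.inl (Finset.mem_insert_of_mem (ServerState.mem_advance_out.2 ⟨hout, hv⟩))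
        · refine Or.inr ⟨t, t1, t2.trans htime, j, ?_⟩
          rw [hearly _ (t2.trans htime), hj]
      · rw [List.mem_singleton.1 hx]
        exact Or.inl (Finset.mem_insert_self _ _)

theorem parallelTour_allServedBy {k : ℕ} {side : Fin k → Bool}
    (hside : Function.Surjective side) {o L R Δ : ℝ} (hL : 0 ≤ L) (hR : 0 ≤ R) (hΔ : 0 ≤ Δ)
    {σ : List Request} (hσ : IsRequestSeq o L R σ)
    (hloc : SpatialLocality Δ (parallelTour side o σ) σ) :
    AllServedBy (parallelTour side o σ) σ (tmax σ + Δ + max L R) := by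
  rw [parallelTour_eq] at hloc ⊢
  have hE := parallelRule_legal side o hL hR
  obtain ⟨⟨p, q, hT⟩, hserved⟩ := parallelRule_teams hside hL hR hΔ hσ hloc
  obtain ⟨i1, i2⟩ := hE.inv_state hσ
  have htime : ((parallelRule side o).state σ).1 = tmax σ := hE.time_state hσ
  have hM := half_add_le_max L R
  have h0 := tmax_nonneg σ
  refine ⟨by linarith, fun r hr => ?_⟩
  have hrel := release_le_tmax r hr
  rcases hserved r hr with hout | ⟨t, t1, t2, j, hj⟩
  · have hv := hT.visits_of_mem hside hΔ (M := max L R) (by linarith) i1 i2 hout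
    obtain ⟨u, u0, u1, j, hj⟩ := hT.visits_min_clearTime hside hΔ i1 i2 hout hv
    refine ⟨tmax σ + u, by linarith, by linarith, j, ?_⟩
    rw [EventRule.strategy_of_ge fun x hx => (release_le_tmax x hx).trans (by linarith), ← hj,
      ← htime]
    change (ServerState.advance side _ (_ + u - _)).pos j = _
    rw [add_sub_cancel_left]
  · exact ⟨t, t1, by linarith, j, hj⟩

theorem parallelTour_isCompetitiveWithLocality {k : ℕ} {side : Fin k → Bool}
    (hside : Function.Surjective side) {o L R Δ c : ℝ} (hL : 0 ≤ L) (hR : 0 ≤ R) (hΔ : 0 ≤ Δ)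
    (hc : Δ ≤ c * max L R) (hc0 : 0 ≤ c) :
    IsCompetitiveWithLocality o L R Δ (parallelTour side o) (2 + c) := by
  refine ⟨parallelTour_eq side o ▸ (parallelRule_legal side o hL hR).isOnline,
    fun σ hσ hs hloc => ?_⟩
  have h := parallelTour_allServedBy hside hL hR hΔ hσ hloc
  have hopt := max_le_OPT (k := k) hside hL hR hσ hs
  have h1 := (le_max_left _ _).trans hopt
  have h2 := (le_max_right _ _).trans hopt
  -- Both t_max and max{L, R} are at most OPT, and Δ ≤ c max{L, R} ≤ c OPT.
  exact ⟨⟨_, h⟩, (cost_le h).trans (by nlinarith [mul_le_mul_of_nonneg_left h2 hc0])⟩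

theorem mainTheorem8 (k : ℕ) (hk : 1 < k) (side : Fin k → Bool)
    (hside : Function.Surjective side) (o L R D Δ δ γ : ℝ)
    (hL : 0 ≤ L) (hR : 0 ≤ R) (hD : D = L + R) (hDpos : 0 < D)
    (hδ0 : 0 ≤ δ) (hδ1 : δ ≤ 1) (hΔ : Δ = δ * D) (hγ : γ = max L R / D) :
    (1 / 2 ≤ γ ∧ γ ≤ 1) ∧
    (∃ B : Strategy k, IsCompetitive o L R B 2.04) ∧
    (∀ B : Strategy k, IsCompetitive o L R B 2.04 →
      IsCompetitiveWithLocality o L R Δ (parallelAlgorithm side o δ γ B)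
        (min 2.04 (2 + δ / γ))) ∧
    IsCompetitiveWithLocality o L R Δ (parallelTour side o) (2 + δ / γ) ∧
    (∀ σ, IsRequestSeq o L R σ → Spans o L R σ →
      max (tmax σ) (max L R) ≤ OPT k o L R σ ∧
      (SpatialLocality Δ (parallelTour side o σ) σ →
        cost (parallelTour side o σ) σ ≤ tmax σ + Δ + max L R)) := by
  have hM := half_add_le_max L R
  have hMpos : 0 < max L R := by linarith
  have hΔ0 : 0 ≤ Δ := hΔ ▸ mul_nonneg hδ0 hDpos.le
  have hγpos : 0 < γ := hγ ▸ div_pos hMpos hDpos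
  have hc : Δ = δ / γ * max L R := by
    rw [hΔ, hγ]
    field_simp
  have hP := parallelTour_isCompetitiveWithLocality (o := o) hside hL hR hΔ0 hc.le
    (div_nonneg hδ0 hγpos.le)
  refine ⟨⟨?_, ?_⟩, ⟨(sweepRule side o L R).strategy, ?_⟩, fun B hB => ?_, hP,
    fun σ hσ hs => ⟨max_le_OPT hside hL hR hσ hs, fun hloc =>
      cost_le (parallelTour_allServedBy hside hL hR hΔ0 hσ hloc)⟩⟩
  · rw [hγ, le_div_iff₀ hDpos]
    linarith
  · rw [hγ, div_le_one hDpos]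
    exact max_le (by linarith) (by linarith)
  · obtain ⟨h1, h2⟩ := sweepRule_isCompetitive (o := o) hside hL hR
    refine ⟨h1, fun σ hσ hs => ⟨(h2 σ hσ hs).1, (h2 σ hσ hs).2.trans ?_⟩⟩
    have := (le_max_right _ _).trans (max_le_OPT hside hL hR hσ hs)
    -- Passing from ratio 2 to 2.04 needs OPT ≥ 0, which follows from OPT ≥ max{L, R}.
    exact mul_le_mul_of_nonneg_right (by norm_num) (hMpos.le.trans this)
  · unfold parallelAlgorithm
    split_ifs with h
    · rw [min_eq_left h]
      exact ⟨hB.1, fun σ hσ hs _ => hB.2 σ hσ hs⟩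
    · rw [min_eq_right (not_le.1 h).le]
      exact hP
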